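/- All graphs are finite and simple. For a positive integer $k$ and a graph $H$, let $gr_k(K_3:H)$ be the smallest $n$ such that every colouring of the edges of $K_n$ with at most $k$ colours contains a rainbow $K_3$ (a triangle whose three edges have pairwise distinct colours) or a monochromatic copy of $H$. Let $K_{N}\sqcup K_{1,s}$ denote the graph obtained from $K_N$ by adding one new vertex joined to exactly $s$ of the vertices of $K_N$. With $n=gr_k(K_3:H)$, the star-critical Gallai–Ramsey number $gr_k^*(K_3:H)$ is the smallest $s$ such that every colouring of the edges of $K_{n-1}\sqcup K_{1,s}$ with at most $k$ colours contains a rainbow $K_3$ or a monochromatic copy of $H$. **Theorem 5.1.** Let $H$ be a graph with at least one vertex and with no isolated vertex. 1. If $H$ is bipartite and not a star $K_{1,m}$, then $gr_k^*(K_3:H)$ is linear in $k$: there are real constants $a,b>0$ depending only on $H$ such that $$a\,k\le gr_k^*(K_3:H)\le b\,k\qquad\text{for all } k\ge 1.$$ 2. If $H$ is not bipartite, then $gr_k^*(K_3:H)$ is exponential in $k$: there are real constants $a,b>0$ and $p,q>1$ depending only on $H$ such that $$a\,p^k\le gr_k^*(K_3:H)\le b\,q^k\qquad\text{for all } k\ge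 1.$$ -/

import Mathlib

namespace GallaiRamsey

open SimpleGraph

/-- `K_N ⊔ K_{1,s}` (for `s ≤ N`): the complete graph on the `N` vertices `some i`, together with a
new vertex `none` joined to exactly `s` of them (the `some i` with `i < s`). -/
def completeWithStar (N s : ℕ) : SimpleGraph (Option (Fin N)) where
  Adj x y :=
    match x, y with
    | some i, some j => i ≠ j
    | none, some j => (j : ℕ) < s
    | some i, none => (i : ℕ) < s
    | none, none => False
  symm := ⟨by
    rintro (_ | i) (_ | j) h
    · exact h
    · exact h
    · exact h
    · exact Ne.symm h⟩
  loopless := ⟨by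
    rintro (_ | i) h
    · exact h
    · exact h rfl⟩

/-- The edge-coloured graph contains a rainbow `K₃`: a triangle with three different colours. -/
def HasRainbowTriangle {W K : Type*} {G : SimpleGraph W} (C : G.EdgeLabeling K) : Prop :=
  ∃ (x y z : W) (hxy : G.Adj x y) (hxz : G.Adj x z) (hyz : G.Adj y z),
    C.get x y hxy ≠ C.get x z hxz ∧ C.get x y hxy ≠ C.get y z hyz ∧
      C.get x z hxz ≠ C.get y z hyz

/-- The edge-coloured graph contains a (not necessarily induced) copy of `H` all of whose edges
have the same colour. -/
def HasMonochromatic {V W K : Type*} {G : SimpleGraph W} (C : G.EdgeLabeling K)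
    (H : SimpleGraph V) : Prop :=
  ∃ c : K, H.IsContained (C.labelGraph c)

/-- Every edge-colouring of `G` with colours from a set of `k` colours contains a rainbow triangle
or a monochromatic copy of `H`. -/
def GallaiArrows {V W : Type*} (k : ℕ) (G : SimpleGraph W) (H : SimpleGraph V) : Prop :=
  ∀ C : G.EdgeLabeling (Fin k), HasRainbowTriangle C ∨ HasMonochromatic C H

/-- The Gallai-Ramsey number `gr_k(K₃ : H)`. -/
noncomputable def gallaiRamsey {V : Type*} (k : ℕ) (H : SimpleGraph V) : ℕ :=
  sInf {n : ℕ | GallaiArrows k (⊤ : SimpleGraph (Fin n)) H}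

/-- The star-critical Gallai-Ramsey number `gr_k^*(K₃ : H)`: with `n = gr_k(K₃ : H)`, the smallest
`s` such that every `k`-edge-coloured `K_{n-1} ⊔ K_{1,s}` contains a rainbow triangle or a
monochromatic copy of `H`. -/
noncomputable def starCriticalGallaiRamsey {V : Type*} (k : ℕ) (H : SimpleGraph V) : ℕ :=
  sInf {s : ℕ | s ≤ gallaiRamsey k H - 1 ∧
    GallaiArrows k (completeWithStar (gallaiRamsey k H - 1) s) H}

/-- `H` is a star `K_{1,m}`: some vertex `r` is joined to all the other vertices, and there are no
further edges. -/
def IsStar {V : Type*} (H : SimpleGraph V) : Prop :=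
  ∃ r : V, H = starGraph r

end GallaiRamsey

/-!
The star-critical number is at most `gr_k(K₃ : H) - 1`, and the point is that it is also at least
`gr_k(K₃ : H) - C` for a constant `C` depending only on `H`
(`GallaiRamsey.gallaiRamsey_le_starCritical_add`). Hence both numbers grow at the same rate.

Write `h = |H|` and `n = gr_k(K₃ : H)`, and take a colouring of `K_{n-1}` without rainbow triangle
and without monochromatic `H`. If `A` is a module (every vertex outside `A` sees `A` in one colour)
with at least `h - 1` vertices, then a new vertex can be joined to everything outside `A` as if it
were a vertex of `A`. Since `H` has no isolated vertex, a monochromatic copy of `H` through the new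
vertex uses a vertex outside `A`, so some vertex of `A` is unused and can take the place of the new
one (`GallaiRamsey.IsModule.not_gallaiArrows_completeWithStar`). So the star-critical number is at
least `n - |A|`.

Modules of bounded size come from Gallai's structure theory. The components of a colour class are
modules, and three different colours cannot all be connected (`GallaiRamsey.not_three_connected`).
So a colouring without nontrivial modules has at most two colours, and its size is bounded by
Ramsey's theorem. Contracting nontrivial modules, with weights, shows that some proper module
contains at least the fraction `4⁻ʰ` of all vertices (`GallaiRamsey.exists_heavy_module`). A minimal
module with at least `m` vertices therefore has at most `4 ^ h * (m + 1)` vertices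
(`GallaiRamsey.exists_module_of_size`).

The same tools bound `gr_k(K₃ : H)` from above. For bipartite `H`, few vertices outside a module of
size at least `h` see it in any given colour, which gives a linear bound. For general `H`, one
descends through large modules, each step using up one of the at most `h` vertices of a
monochromatic clique of some colour, which gives an exponential bound. The lower bounds come from
the colouring `min x y`, whose colour classes are stars, and from the first position where two
`0`-`1` sequences differ, whose colour classes are bipartite.
-/

namespace GallaiRamsey

open SimpleGraph Finset

/-- A Gallai colouring of the complete graph on `W`, encoded as a symmetric function on all pairs:
no triangle has three different colours. For repeated vertices the second condition follows from
symmetry, so the (irrelevant) values on the diagonal are not constrained. -/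
structure IsGallai {W K : Type*} (c : W → W → K) : Prop where
  symm : ∀ x y, c x y = c y x
  tri : ∀ x y z, c x y = c x z ∨ c x y = c y z ∨ c x z = c y z

/-- `A` is a module (homogeneous set) of the coloured complete graph on `S`: every vertex of `S`
outside `A` is joined to all of `A` in a single colour. -/
def IsModule {W K : Type*} (c : W → W → K) (S A : Finset W) : Prop :=
  A ⊆ S ∧ ∀ x ∈ A, ∀ x' ∈ A, ∀ y ∈ S, y ∉ A → c x y = c x' y

/-- All pairs of distinct elements of `T` have colour `i`. -/
def IsMonoClique {W K : Type*} (c : W → W → K) (i : K) (T : Finset W) : Prop :=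
  ∀ x ∈ T, ∀ y ∈ T, x ≠ y → c x y = i

/-- `y` can be reached from `x` by a walk of colour `i` inside `S`. -/
def ColorReach {W K : Type*} (c : W → W → K) (i : K) (S : Finset W) : W → W → Prop :=
  Relation.ReflTransGen (fun a b => a ∈ S ∧ b ∈ S ∧ c a b = i)

/-- The edges of colour `i` inside `S` form a connected spanning graph on `S`. -/
def ColorConnected {W K : Type*} (c : W → W → K) (i : K) (S : Finset W) : Prop :=
  ∀ x ∈ S, ∀ y ∈ S, ColorReach c i S x y

/-! ### Connected colour classes of a Gallai colouring -/

section Gallai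

variable {W K : Type*} {c : W → W → K} {i j l : K} {S : Finset W}

lemma ColorReach.symm (hc : IsGallai c) {x y : W} (h : ColorReach c i S x y) :
    ColorReach c i S y x := by
  induction h with
  | refl => exact .refl
  | tail _ hab ih => exact .head ⟨hab.2.1, hab.1, by rw [hc.symm, hab.2.2]⟩ ih

lemma ColorReach.mem {x y : W} (h : ColorReach c i S x y) (hx : x ∈ S) : y ∈ S := by
  induction h with
  | refl => exact hx
  | tail _ h _ => exact h.2.1

/-- The components of a colour class are modules. -/
lemma ColorReach.color_eq (hc : IsGallai c) {x x' y : W} (h : ColorReach c i S x x')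
    (hy : y ∈ S) (hxy : ¬ ColorReach c i S x y) : c x' y = c x y := by
  induction h with
  | refl => rfl
  | @tail a b hxa hab ih =>
    obtain ⟨ha, hb, hi⟩ := hab
    have h1 : c a y ≠ i := fun h => hxy (hxa.tail ⟨ha, hy, h⟩)
    have h2 : c b y ≠ i := fun h => hxy ((hxa.tail ⟨ha, hb, hi⟩).tail ⟨hb, hy, h⟩)
    rcases hc.tri a b y with h | h | h
    · exact absurd (h.symm.trans hi) h1
    · exact absurd (h.symm.trans hi) h2
    · rw [← h, ih]

lemma exists_color_of_not_reach {x y : W} (hx : x ∈ S) (hy : y ∈ S)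
    (h : ¬ ColorReach c i S x y) : c x y ≠ i :=
  fun hi => h (.single ⟨hx, hy, hi⟩)

variable [DecidableEq W]

/-- If colour `i` is connected on `S`, then after deletion of `v` every component of colour `i`
contains a neighbour of `v` in colour `i`. -/
lemma ColorConnected.exists_reach_erase (hc : IsGallai c) (h : ColorConnected c i S) {v x : W}
    (hv : v ∈ S) (hx : x ∈ S.erase v) :
    ∃ x', ColorReach c i (S.erase v) x x' ∧ c v x' = i := by
  by_contra! hne
  have key : ∀ y, ColorReach c i S x y → ColorReach c i (S.erase v) x y ∧ y ∈ S.erase v := by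
    intro y hy
    induction hy with
    | refl => exact ⟨.refl, hx⟩
    | @tail b d _ hbd ih =>
      obtain ⟨_, hd, hi⟩ := hbd
      have hdv : d ≠ v := by
        rintro rfl
        exact hne b ih.1 (by rw [hc.symm, hi])
      have hd' : d ∈ S.erase v := mem_erase.2 ⟨hdv, hd⟩
      exact ⟨ih.1.tail ⟨ih.2, hd', hi⟩, hd'⟩
  exact notMem_erase v S (key v (h x (mem_of_mem_erase hx) v hv)).2

/-- If three colours are connected on `S`, they remain so after deletion of a vertex. -/
lemma ColorConnected.erase (hc : IsGallai c) (hi : ColorConnected c i S)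
    (hj : ColorConnected c j S) (hl : ColorConnected c l S) (hij : i ≠ j) (hil : i ≠ l)
    (hjl : j ≠ l) {v : W} (hv : v ∈ S) : ColorConnected c i (S.erase v) := by
  intro p hp q hq
  by_contra hpq
  obtain ⟨y, hpy, hvy⟩ := hj.exists_reach_erase hc hv hp
  obtain ⟨z, hpz, hvz⟩ := hl.exists_reach_erase hc hv hp
  have hy := hpy.mem hp
  have hz := hpz.mem hp
  -- if `v` sees `u` in colour `m` and sees `x`, in another component, in colour `i`, then the edge
  -- `x u` has colour `m`
  have hcol : ∀ (u x : W) (m : K), i ≠ m → u ∈ S.erase v → x ∈ S.erase v → c v u = m →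
      c v x = i → ¬ ColorReach c i (S.erase v) x u → c x u = m := by
    intro u x m him hu hx hvu hvx hxu
    have h1 := exists_color_of_not_reach hx hu hxu
    rcases hc.tri v x u with h | h | h
    · exact absurd (hvx.symm.trans (h.trans hvu)) him
    · exact absurd (h.symm.trans hvx) h1
    · exact h.symm.trans hvu
  by_cases hyz : ColorReach c i (S.erase v) y z
  · obtain ⟨x₀, hx₀, hyx₀⟩ : ∃ x ∈ S.erase v, ¬ ColorReach c i (S.erase v) y x := by
      by_cases h : ColorReach c i (S.erase v) y p
      · exact ⟨q, hq, fun h' => hpq ((h.symm hc).trans h')⟩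
      · exact ⟨p, hp, h⟩
    obtain ⟨x, hx₀x, hvx⟩ := hi.exists_reach_erase hc hv hx₀
    have hx := hx₀x.mem hx₀
    have hyx : ¬ ColorReach c i (S.erase v) y x := fun h => hyx₀ (h.trans (hx₀x.symm hc))
    have e1 := hcol y x j hij hy hx hvy hvx (fun h => hyx (h.symm hc))
    have e2 := hcol z x l hil hz hx hvz hvx (fun h => hyx (hyz.trans (h.symm hc)))
    have e3 := hyz.color_eq hc hx hyx
    rw [hc.symm z, hc.symm y, e1, e2] at e3
    exact hjl e3.symm
  · have hzy : ¬ ColorReach c i (S.erase v) z y := fun h => hyz (h.symm hc)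
    obtain ⟨x, hyx, hvx⟩ := hi.exists_reach_erase hc hv hy
    obtain ⟨x', hzx', hvx'⟩ := hi.exists_reach_erase hc hv hz
    have e1 := hcol z x l hil hz (hyx.mem hy) hvz hvx (fun h => hyz (hyx.trans h))
    have e2 := hcol y x' j hij hy (hzx'.mem hz) hvy hvx' (fun h => hzy (hzx'.trans h))
    rw [hyx.color_eq hc hz hyz] at e1
    rw [hzx'.color_eq hc hy hzy, hc.symm, e1] at e2
    exact hjl e2.symm

/-- Gallai's lemma: at most two colours of a Gallai colouring are connected. -/
lemma not_three_connected (hc : IsGallai c) (hij : i ≠ j) (hil : i ≠ l) (hjl : j ≠ l)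
    (hS : 2 ≤ #S) (hi : ColorConnected c i S) (hj : ColorConnected c j S)
    (hl : ColorConnected c l S) : False := by
  induction S using Finset.strongInduction with
  | H S ih =>
    obtain ⟨v, hv⟩ : S.Nonempty := card_pos.1 (by omega)
    have hcard := card_erase_of_mem hv
    by_cases h2 : #S = 2
    · obtain ⟨w, hw⟩ := card_eq_one.1 (show #(S.erase v) = 1 by omega)
      have hwm : w ∈ S.erase v := by simp [hw]
      obtain ⟨x, hx, hvx⟩ := hi.exists_reach_erase hc hv hwm
      obtain ⟨y, hy, hvy⟩ := hj.exists_reach_erase hc hv hwm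
      have hx' := hx.mem hwm
      have hy' := hy.mem hwm
      rw [hw, mem_singleton] at hx' hy'
      subst hx' hy'
      exact hij (hvx.symm.trans hvy)
    · exact ih _ (erase_ssubset hv) (by omega)
        (hi.erase hc hj hl hij hil hjl hv)
        (hj.erase hc hi hl hij.symm hjl hil hv)
        (hl.erase hc hi hj hil.symm hjl.symm hij hv)

end Gallai

/-! ### Large modules -/

/-- Ramsey's theorem for graphs, with the bound `2 ^ (a + b)`. -/
lemma exists_clique_or_indep {W : Type*} [DecidableEq W] (P : W → W → Prop)
    (hP : ∀ x y, P x y → P y x) (a b : ℕ) (S : Finset W) (hS : 2 ^ (a + b) ≤ #S) :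
    ∃ T ⊆ S, (#T = a ∧ ∀ x ∈ T, ∀ y ∈ T, x ≠ y → P x y) ∨
      (#T = b ∧ ∀ x ∈ T, ∀ y ∈ T, x ≠ y → ¬ P x y) := by
  classical
  induction a generalizing b S with
  | zero => exact ⟨∅, by simp, by simp⟩
  | succ a iha =>
    induction b generalizing S with
    | zero => exact ⟨∅, by simp, by simp⟩
    | succ b ihb =>
      obtain ⟨v, hv⟩ : S.Nonempty := card_pos.1 (lt_of_lt_of_le (by positivity) hS)
      have h1 := card_erase_of_mem hv
      have h2 := card_filter_add_card_filter_not (s := S.erase v) (P v)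
      have h3 : 2 ^ (a + 1 + (b + 1)) = 2 ^ (a + (b + 1)) + 2 ^ (a + 1 + b) := by ring
      have hsub : ∀ (Q : W → Prop) [DecidablePred Q], (S.erase v).filter Q ⊆ S :=
        fun Q _ => (filter_subset _ _).trans (erase_subset _ _)
      have hvT : ∀ (Q : W → Prop) [DecidablePred Q] (T : Finset W),
          T ⊆ (S.erase v).filter Q → v ∉ T :=
        fun Q _ T hT hvT => notMem_erase v S (mem_filter.1 (hT hvT)).1
      by_cases hlarge : 2 ^ (a + (b + 1)) ≤ #((S.erase v).filter (P v))
      · obtain ⟨T, hT, ⟨hcard, hcl⟩ | hind⟩ := iha _ _ hlarge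
        · refine ⟨insert v T, insert_subset hv (hT.trans (hsub _)), Or.inl ⟨?_, ?_⟩⟩
          · rw [card_insert_of_notMem (hvT _ T hT), hcard]
          · have hvx : ∀ x ∈ T, P v x := fun x hx => (mem_filter.1 (hT hx)).2
            intro x hx y hy hxy
            rcases mem_insert.1 hx with rfl | hxT <;> rcases mem_insert.1 hy with rfl | hyT
            · exact absurd rfl hxy
            · exact hvx y hyT
            · exact hP _ _ (hvx x hxT)
            · exact hcl x hxT y hyT hxy
        · exact ⟨T, hT.trans (hsub _), Or.inr hind⟩
      · obtain ⟨T, hT, hcl | ⟨hcard, hind⟩⟩ :=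
          ihb ((S.erase v).filter (fun x => ¬ P v x)) (by omega)
        · exact ⟨T, hT.trans (hsub _), Or.inl hcl⟩
        · refine ⟨insert v T, insert_subset hv (hT.trans (hsub _)), Or.inr ⟨?_, ?_⟩⟩
          · rw [card_insert_of_notMem (hvT _ T hT), hcard]
          · have hvx : ∀ x ∈ T, ¬ P v x := fun x hx => (mem_filter.1 (hT hx)).2
            intro x hx y hy hxy
            rcases mem_insert.1 hx with rfl | hxT <;> rcases mem_insert.1 hy with rfl | hyT
            · exact absurd rfl hxy
            · exact hvx y hyT
            · exact fun h => hvx x hxT (hP _ _ h)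
            · exact hind x hxT y hyT hxy

section Module

variable {W K : Type*} [DecidableEq W] {c : W → W → K} {S A B : Finset W} {h : ℕ}

lemma IsModule.trans (hB : IsModule c S B) (hA : IsModule c B A) :
    IsModule c S A := by
  refine ⟨hA.1.trans hB.1, fun x hx x' hx' y hy hyA => ?_⟩
  by_cases hyB : y ∈ B
  · exact hA.2 x hx x' hx' y hyB hyA
  · exact hB.2 x (hA.1 hx) x' (hA.1 hx') y hy hyB

/-- A Gallai colouring without nontrivial modules uses at most two colours, hence it contains a
large monochromatic clique if it is large. -/
lemma card_lt_of_prime (hc : IsGallai c) (hS : 2 ≤ #S)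
    (hclique : ∀ T ⊆ S, ∀ i, IsMonoClique c i T → #T < h)
    (hprime : ∀ B, IsModule c S B → 2 ≤ #B → B = S) : #S < 4 ^ h := by
  classical
  by_contra! hlarge
  have hconn : ∀ x ∈ S, ∀ y ∈ S, x ≠ y → ColorConnected c (c x y) S := by
    intro x hx y hy hxy
    have hB : IsModule c S (S.filter (ColorReach c (c x y) S x)) := by
      refine ⟨filter_subset _ _, fun u hu u' hu' z hz hzB => ?_⟩
      have hxz : ¬ ColorReach c (c x y) S x z := fun h => hzB (mem_filter.2 ⟨hz, h⟩)
      rw [(mem_filter.1 hu).2.color_eq hc hz hxz, (mem_filter.1 hu').2.color_eq hc hz hxz]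
    have hBS := hprime _ hB (by
      refine le_trans (card_pair hxy).ge (card_le_card ?_)
      intro u hu
      rcases mem_insert.1 hu with rfl | hu
      · exact mem_filter.2 ⟨hx, .refl⟩
      · rw [mem_singleton.1 hu]
        exact mem_filter.2 ⟨hy, .single ⟨hx, hy, rfl⟩⟩)
    intro u hu w hw
    rw [← hBS, mem_filter] at hu hw
    exact (hu.2.symm hc).trans hw.2
  obtain ⟨x₀, hx₀, y₀, hy₀, hne₀⟩ := one_lt_card.1 (show 1 < #S by omega)
  obtain ⟨T, hT, ⟨hcard, hmono⟩ | ⟨hcard, hmono⟩⟩ := exists_clique_or_indep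
    (fun x y => c x y = c x₀ y₀) (fun x y hxy => by rw [hc.symm, hxy]) h h S
    (by rwa [← two_mul, pow_mul])
  · exact (hclique T hT _ hmono).ne hcard
  · -- all colours on `T` coincide, as two different ones would be connected together with the
    -- colour of `x₀ y₀`
    obtain ⟨i, hi⟩ : ∃ i, IsMonoClique c i T := by
      by_cases hedge : ∃ x ∈ T, ∃ y ∈ T, x ≠ y
      · obtain ⟨x, hx, y, hy, hxy⟩ := hedge
        refine ⟨c x y, fun u hu w hw huw => ?_⟩
        by_contra hdiff
        exact not_three_connected hc (hmono u hu w hw huw) hdiff (Ne.symm (hmono x hx y hy hxy)) hS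
          (hconn u (hT hu) w (hT hw) huw) (hconn _ hx₀ _ hy₀ hne₀)
          (hconn x (hT hx) y (hT hy) hxy)
      · push Not at hedge
        exact ⟨c x₀ y₀, fun u hu w hw huw => absurd (hedge u hu w hw) huw⟩
    exact (hclique T hT i hi).ne hcard

/-- A weighted form of Gallai's structure theorem, for a Gallai colouring without monochromatic
`K_h`: some proper module carries at least the fraction `4⁻ʰ` of the total weight. The weights
make it possible to contract a nontrivial module to one vertex, which inherits its weight. -/
lemma exists_heavy_module (hc : IsGallai c) (w : W → ℕ) (hS : 2 ≤ #S)
    (hclique : ∀ T ⊆ S, ∀ i, IsMonoClique c i T → #T < h) :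
    ∃ A, A ⊂ S ∧ IsModule c S A ∧ ∑ x ∈ S, w x ≤ 4 ^ h * ∑ x ∈ A, w x := by
  induction hn : #S using Nat.strong_induction_on generalizing S w with
  | _ n ih =>
  by_cases hprime : ∀ B, IsModule c S B → 2 ≤ #B → B = S
  · obtain ⟨a, ha, hmax⟩ := exists_max_image S w (card_pos.1 (by omega))
    refine ⟨{a}, ?_, ⟨by simpa using ha, ?_⟩, ?_⟩
    · refine ssubset_of_subset_of_ne (by simpa using ha) ?_
      rintro rfl
      simp at hS
    · intro x hx x' hx' y _ _
      rw [mem_singleton.1 hx, mem_singleton.1 hx']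
    · rw [sum_singleton]
      calc ∑ x ∈ S, w x ≤ #S * w a := by simpa using sum_le_card_nsmul S w (w a) hmax
        _ ≤ 4 ^ h * w a :=
          Nat.mul_le_mul_right _ (card_lt_of_prime hc hS hclique hprime).le
  · push Not at hprime
    obtain ⟨B, hB, hB2, hBS⟩ := hprime
    obtain ⟨a, ha⟩ : B.Nonempty := card_pos.1 (by omega)
    have hdisj : a ∉ S \ B := by simp [ha]
    have hcardB := card_sdiff_add_card_eq_card hB.1
    have hlt := card_lt_card (ssubset_of_subset_of_ne hB.1 hBS)
    have hcard' : #(insert a (S \ B)) = #(S \ B) + 1 := card_insert_of_notMem hdisj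
    have hS'S : insert a (S \ B) ⊆ S := insert_subset (hB.1 ha) sdiff_subset
    -- the weight after contraction of `B` to `a`
    set w' : W → ℕ := fun x => if x = a then ∑ x ∈ B, w x else w x
    have hsum : ∀ D : Finset W, a ∉ D → ∑ x ∈ D, w' x = ∑ x ∈ D, w x := by
      intro D hD
      refine sum_congr rfl fun x hx => if_neg ?_
      rintro rfl
      exact hD hx
    have hw'a : w' a = ∑ x ∈ B, w x := if_pos rfl
    obtain ⟨A, hAS, hA, hAw⟩ := ih #(insert a (S \ B)) (by omega) w' (S := insert a (S \ B))
      (by omega) (fun T hT => hclique T (hT.trans hS'S)) rfl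
    have htot : ∑ x ∈ insert a (S \ B), w' x = ∑ x ∈ S, w x := by
      rw [sum_insert hdisj, hsum _ hdisj, hw'a, add_comm, sum_sdiff hB.1]
    rw [htot] at hAw
    obtain ⟨z, hzS, hzA⟩ := exists_of_ssubset hAS
    by_cases haA : a ∈ A
    · have hzB : z ∉ B := by
        rcases mem_insert.1 hzS with rfl | h
        · exact absurd haA hzA
        · exact (mem_sdiff.1 h).2
      have hdisj2 : Disjoint (A.erase a) B := by
        rw [Finset.disjoint_left]
        intro x hx hxB
        rcases mem_insert.1 (hA.1 (mem_of_mem_erase hx)) with rfl | h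
        · exact notMem_erase _ _ hx
        · exact (mem_sdiff.1 h).2 hxB
      refine ⟨A.erase a ∪ B, ssubset_of_subset_of_ne ?_ ?_, ⟨?_, ?_⟩, ?_⟩
      · exact union_subset ((erase_subset _ _).trans (hA.1.trans hS'S)) hB.1
      · intro h
        have := hS'S hzS
        rw [← h, mem_union] at this
        exact this.elim (fun h => hzA (mem_of_mem_erase h)) hzB
      · exact union_subset ((erase_subset _ _).trans (hA.1.trans hS'S)) hB.1
      · have key : ∀ x ∈ A.erase a ∪ B, ∀ y ∈ S, y ∉ A.erase a ∪ B → c x y = c a y := by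
          intro x hx y hy hyA
          rw [mem_union, not_or] at hyA
          have hya : y ≠ a := fun h => hyA.2 (h ▸ ha)
          rcases mem_union.1 hx with hx | hx
          · exact hA.2 x (mem_of_mem_erase hx) a haA y
              (mem_insert_of_mem (mem_sdiff.2 ⟨hy, hyA.2⟩))
              (fun h => hyA.1 (mem_erase.2 ⟨hya, h⟩))
          · exact hB.2 x hx a ha y hy hyA.2
        intro x hx x' hx' y hy hyA
        rw [key x hx y hy hyA, key x' hx' y hy hyA]
      · rwa [sum_union hdisj2, ← hsum _ (notMem_erase a A), ← hw'a, sum_erase_add _ _ haA]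
    · have hAB : ∀ x ∈ A, x ∉ B := by
        intro x hx
        rcases mem_insert.1 (hA.1 hx) with rfl | h
        · exact absurd hx haA
        · exact (mem_sdiff.1 h).2
      refine ⟨A, ssubset_of_subset_of_ne (hA.1.trans hS'S) ?_, ⟨hA.1.trans hS'S, ?_⟩, ?_⟩
      · rintro rfl
        exact haA (hB.1 ha)
      · intro x hx x' hx' y hy hyA
        by_cases hyB : y ∈ B
        · have h1 : ∀ u ∈ A, c u y = c u a := fun u hu => by
            rw [hc.symm u, hc.symm u]
            exact hB.2 y hyB a ha u (hS'S (hA.1 hu)) (hAB u hu)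
          rw [h1 x hx, h1 x' hx']
          exact hA.2 x hx x' hx' a (mem_insert_self _ _) haA
        · exact hA.2 x hx x' hx' y (mem_insert_of_mem (mem_sdiff.2 ⟨hy, hyB⟩)) hyA
      · rwa [← hsum A haA]

/-- The unweighted case of `exists_heavy_module`. -/
lemma exists_large_module (hc : IsGallai c) (hS : 2 ≤ #S)
    (hclique : ∀ T ⊆ S, ∀ i, IsMonoClique c i T → #T < h) :
    ∃ A, A ⊂ S ∧ IsModule c S A ∧ #S ≤ 4 ^ h * #A := by
  simpa using exists_heavy_module hc (fun _ => 1) hS hclique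

/-- Modules exist at every scale: a module that is minimal among those with at least `m` vertices
has at most `4 ^ h * (m + 1)` vertices. -/
lemma exists_module_of_size (hc : IsGallai c) (m : ℕ) (hm : m ≤ #S)
    (hclique : ∀ T ⊆ S, ∀ i, IsMonoClique c i T → #T < h) :
    ∃ A, IsModule c S A ∧ m ≤ #A ∧ #A ≤ 4 ^ h * (m + 1) := by
  classical
  have hself : IsModule c S S := ⟨Subset.rfl, fun _ _ _ _ y hy hy' => absurd hy hy'⟩
  obtain ⟨A, hA, hmin⟩ := exists_min_image
    (S.powerset.filter (fun A => IsModule c S A ∧ m ≤ #A)) card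
    ⟨S, by simp [hself, hm]⟩
  rw [mem_filter] at hA
  refine ⟨A, hA.2.1, hA.2.2, ?_⟩
  by_contra! hbig
  have h4 : 1 ≤ 4 ^ h := Nat.one_le_pow _ _ (by norm_num)
  by_cases hA2 : 2 ≤ #A
  · obtain ⟨B, hBA, hB, hcard⟩ := exists_large_module hc hA2
      (fun T hT => hclique T (hT.trans hA.2.1.1))
    have hmB : m + 1 < #B := by
      by_contra! hle
      exact absurd (hcard.trans (Nat.mul_le_mul_left _ hle)) (by omega)
    have := hmin B (mem_filter.2
      ⟨mem_powerset.2 (hBA.subset.trans hA.2.1.1), hA.2.1.trans hB, by omega⟩)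
    exact absurd (card_lt_card hBA) (by omega)
  · nlinarith

/-- If monochromatic cliques of colour `i` have at most `b i` vertices, then a Gallai colouring has
at most `(4 ^ h) ^ ∑ b i` vertices: a vertex outside a large proper module `A` extends all the
cliques in `A` of the colour by which it is joined to `A`. -/
lemma card_le_pow_sum [Fintype K] [DecidableEq K] (hc : IsGallai c) (b : K → ℕ)
    (hclique : ∀ T ⊆ S, ∀ i, IsMonoClique c i T → #T < h)
    (hb : ∀ T ⊆ S, ∀ i, IsMonoClique c i T → #T ≤ b i) :
    #S ≤ (4 ^ h) ^ ∑ i, b i := by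
  induction hn : ∑ i, b i using Nat.strong_induction_on generalizing S b with
  | _ n ih =>
  by_cases hS : 2 ≤ #S
  · obtain ⟨A, hAS, hA, hcard⟩ := exists_large_module hc hS hclique
    obtain ⟨x, hxS, hxA⟩ := exists_of_ssubset hAS
    obtain ⟨a, ha⟩ : A.Nonempty := by
      rw [nonempty_iff_ne_empty]
      rintro rfl
      rw [card_empty] at hcard
      omega
    have hext : ∀ T ⊆ A, IsMonoClique c (c a x) T → #T + 1 ≤ b (c a x) := by
      intro T hT hmono
      rw [← card_insert_of_notMem (fun h => hxA (hT h))]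
      refine hb _ (insert_subset hxS (hT.trans hA.1)) _ ?_
      have hx : ∀ u ∈ T, c u x = c a x := fun u hu => hA.2 u (hT hu) a ha x hxS hxA
      intro u hu v hv huv
      rcases mem_insert.1 hu with rfl | huT <;> rcases mem_insert.1 hv with rfl | hvT
      · exact absurd rfl huv
      · rw [hc.symm, hx v hvT]
      · exact hx u huT
      · exact hmono u huT v hvT huv
    have hpos : 1 ≤ b (c a x) := hext ∅ (by simp) (by simp [IsMonoClique])
    have hsum : ∑ i, Function.update b (c a x) (b (c a x) - 1) i + 1 = n := by
      rw [sum_update_of_mem (mem_univ _), ← hn, ← add_sum_erase _ _ (mem_univ (c a x)),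
        sdiff_singleton_eq_erase]
      omega
    have := ih _ (by omega) (S := A) (Function.update b (c a x) (b (c a x) - 1))
      (fun T hT => hclique T (hT.trans hA.1)) (by
        intro T hT i hmono
        by_cases hi : i = c a x
        · subst hi
          rw [Function.update_self]
          have := hext T hT hmono
          omega
        · rw [Function.update_of_ne hi]
          exact hb T (hT.trans hA.1) i hmono) rfl
    calc #S ≤ 4 ^ h * #A := hcard
      _ ≤ 4 ^ h * (4 ^ h) ^ ∑ i, Function.update b (c a x) (b (c a x) - 1) i :=
        Nat.mul_le_mul_left _ this
      _ = (4 ^ h) ^ n := by rw [← hsum, pow_succ, mul_comm]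
  · exact (show #S ≤ 1 by omega).trans (Nat.one_le_pow _ _ (by positivity))

end Module

/-! ### Edge labelings and colour functions -/

/-- The coloured complete graph on `W` has no monochromatic copy of `H`. -/
def NoMono {V W K : Type*} (c : W → W → K) (H : SimpleGraph V) : Prop :=
  ∀ (i : K) (f : V → W), Function.Injective f → ¬ ∀ u v, H.Adj u v → c (f u) (f v) = i

section Transfer

variable {V W W' K : Type*} {H : SimpleGraph V} {k : ℕ}

lemma IsGallai.comp {c : W → W → K} (hc : IsGallai c) (φ : W' → W) :
    IsGallai (fun x y => c (φ x) (φ y)) :=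
  ⟨fun _ _ => hc.symm _ _, fun _ _ _ => hc.tri _ _ _⟩

lemma not_gallaiArrows_of_color (G : SimpleGraph W) {c : W → W → Fin k} (hc : IsGallai c)
    (hno : ∀ (i : Fin k) (f : V → W), Function.Injective f →
      ¬ ∀ u v, H.Adj u v → G.Adj (f u) (f v) ∧ c (f u) (f v) = i) :
    ¬ GallaiArrows k G H := by
  intro harr
  rcases harr (EdgeLabeling.mk (fun x y _ => c x y) (fun x y _ => hc.symm y x)) with
    ⟨x, y, z, hxy, hxz, hyz, h1, h2, h3⟩ | ⟨i, ⟨f⟩⟩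
  · rcases hc.tri x y z with h | h | h
    · exact h1 h
    · exact h2 h
    · exact h3 h
  · refine hno i f f.injective fun u v huv => ?_
    obtain ⟨hG, hi⟩ := (EdgeLabeling.labelGraph_adj _ _).1 (f.toHom.map_adj huv)
    exact ⟨hG, hi⟩

lemma NoMono.not_gallaiArrows {c : W → W → Fin k} (hno : NoMono c H) (hc : IsGallai c) :
    ¬ GallaiArrows k (⊤ : SimpleGraph W) H :=
  not_gallaiArrows_of_color _ hc fun i f hf h => hno i f hf fun u v huv => (h u v huv).2

lemma exists_color_of_not_gallaiArrows (hk : 1 ≤ k)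
    (h : ¬ GallaiArrows k (⊤ : SimpleGraph W) H) :
    ∃ c : W → W → Fin k, IsGallai c ∧ NoMono c H := by
  classical
  unfold GallaiArrows at h
  push Not at h
  obtain ⟨C, hrain, hmono⟩ := h
  have hsymm : ∀ x y : W, (if h : x ≠ y then C.get x y h else (⟨0, hk⟩ : Fin k)) =
      if h : y ≠ x then C.get y x h else ⟨0, hk⟩ := by
    intro x y
    by_cases hxy : x = y
    · subst hxy; rfl
    · rw [dif_pos hxy, dif_pos (Ne.symm hxy)]
      exact EdgeLabeling.get_comm _ _ _
  refine ⟨fun x y => if h : x ≠ y then C.get x y h else ⟨0, hk⟩, ⟨hsymm, ?_⟩, ?_⟩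
  · intro x y z
    by_cases hxy : x = y
    · subst hxy; exact Or.inr (Or.inr rfl)
    by_cases hyz : y = z
    · subst hyz; exact Or.inl rfl
    by_cases hxz : x = z
    · subst hxz; exact Or.inr (Or.inl (hsymm _ _))
    simp only [dif_pos hxy, dif_pos hyz, dif_pos hxz]
    by_contra! hne
    exact hrain ⟨x, y, z, hxy, hxz, hyz, hne.1, hne.2.1, hne.2.2⟩
  · intro i f hf hall
    refine hmono ⟨i, ⟨⟨⟨f, fun {u v} huv => ?_⟩, hf⟩⟩⟩
    have hne : f u ≠ f v := fun h => huv.ne (hf h)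
    rw [TopEdgeLabeling.labelGraph_adj]
    exact ⟨hne, (dif_pos hne).symm.trans (hall u v huv)⟩

lemma GallaiArrows.mono {G : SimpleGraph W} {G' : SimpleGraph W'} (h : GallaiArrows k G H)
    (f : Copy G G') : GallaiArrows k G' H := by
  intro C
  rcases h (C.pullback f.toHom) with ⟨x, y, z, hxy, hxz, hyz, h1, h2, h3⟩ | ⟨i, ⟨g⟩⟩
  · exact Or.inl ⟨f x, f y, f z, f.toHom.map_adj hxy, f.toHom.map_adj hxz, f.toHom.map_adj hyz,
      h1, h2, h3⟩
  · refine Or.inr ⟨i, ⟨⟨⟨f ∘ g, fun {u v} huv => ?_⟩, f.injective.comp g.injective⟩⟩⟩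
    obtain ⟨hG, hi⟩ := (EdgeLabeling.labelGraph_adj _ _).1 (g.toHom.map_adj huv)
    exact (EdgeLabeling.labelGraph_adj _ _).2 ⟨f.toHom.map_adj hG, hi⟩

lemma NoMono.card_clique_lt [Fintype V] {c : W → W → K} (hno : NoMono c H) (T : Finset W) (i : K)
    (hT : IsMonoClique c i T) : #T < Fintype.card V := by
  by_contra! hle
  obtain ⟨f⟩ := Function.Embedding.nonempty_of_card_le (α := V) (β := T) (by simpa using hle)
  exact hno i (fun v => f v) (Subtype.val_injective.comp f.injective) fun u v huv =>
    hT _ (f u).2 _ (f v).2 fun h => huv.ne (f.injective (Subtype.ext h))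

end Transfer

/-! ### Bounds on the Gallai-Ramsey number -/

section Bounds

variable {V : Type*} [Fintype V] {H : SimpleGraph V} {k : ℕ}

/-- The exponential upper bound, valid for every `H`. -/
lemma NoMono.card_le_pow {n : ℕ} {c : Fin n → Fin n → Fin k} (hno : NoMono c H)
    (hc : IsGallai c) :
    n ≤ (4 ^ Fintype.card V) ^ (k * Fintype.card V) := by
  have := card_le_pow_sum (S := univ) hc (fun _ => Fintype.card V)
    (fun T _ i hT => hno.card_clique_lt T i hT) (fun T _ i hT => (hno.card_clique_lt T i hT).le)
  simpa using this

/-- For bipartite `H`, at most `|H|` vertices outside a module `A` with `|A| ≥ |H|` are joined to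
`A` in a given colour, as otherwise this colour contains a large complete bipartite graph. -/
lemma NoMono.card_le_of_isBipartite {n : ℕ} {c : Fin n → Fin n → Fin k} (hno : NoMono c H)
    (hc : IsGallai c) (hH : H.IsBipartite) :
    n ≤ 4 ^ Fintype.card V * (Fintype.card V + 1) + k * Fintype.card V := by
  obtain ⟨h, hh⟩ : ∃ h, h = Fintype.card V := ⟨_, rfl⟩
  rw [← hh]
  rcases lt_or_ge n h with hn | hn
  · have : h ≤ 4 ^ h * (h + 1) := by
      calc h ≤ 1 * (h + 1) := by omega
        _ ≤ 4 ^ h * (h + 1) := Nat.mul_le_mul_right _ (Nat.one_le_pow _ _ (by norm_num))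
    omega
  obtain ⟨A, hA, hhA, hAle⟩ := exists_module_of_size (S := univ) hc h (by simpa using hn)
    (fun T _ i hT => hh ▸ hno.card_clique_lt T i hT)
  have hcompl : #(univ \ A) ≤ k * h := by
    rcases A.eq_empty_or_nonempty with rfl | ⟨a, ha⟩
    · -- then `H` has no vertices, and the empty map is a copy of `H`
      have hV : IsEmpty V := Fintype.card_eq_zero_iff.1 (by simpa [hh] using hhA)
      rcases isEmpty_or_nonempty (Fin k) with hk | ⟨⟨i⟩⟩
      · rcases isEmpty_or_nonempty (Fin n) with hn' | ⟨⟨x⟩⟩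
        · simp
        · exact hk.elim (c x x)
      · exact (hno i isEmptyElim (fun x => isEmptyElim x) fun u => isEmptyElim u).elim
    have hfib : ∀ i : Fin k, #((univ \ A).filter (fun y => c a y = i)) ≤ h := by
      intro i
      by_contra! hbig
      obtain ⟨α⟩ := Function.Embedding.nonempty_of_card_le (α := V)
        (β := ((univ \ A).filter (fun y => c a y = i) : Finset _))
        (by rw [Fintype.card_coe]; exact hh ▸ hbig.le)
      obtain ⟨β⟩ := Function.Embedding.nonempty_of_card_le (α := V) (β := A)
        (by rw [Fintype.card_coe]; exact hh ▸ hhA)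
      obtain ⟨col⟩ := hH
      have hα : ∀ v, (α v : Fin n) ∉ A := fun v => by
        have := (mem_filter.1 (α v).2).1
        exact (mem_sdiff.1 this).2
      have hcol : ∀ u v, c (β u) (α v) = i := fun u v => by
        rw [hA.2 _ (β u).2 a ha _ (mem_univ _) (hα v)]
        exact (mem_filter.1 (α v).2).2
      refine hno i (fun v => if col v = 0 then (α v : Fin n) else β v) ?_ ?_
      · intro u v huv
        dsimp only at huv
        split_ifs at huv with h1 h2 h2
        · exact α.injective (Subtype.ext huv)
        · exact absurd (huv ▸ (β v).2) (hα u)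
        · exact absurd (huv ▸ (β u).2) (hα v)
        · exact β.injective (Subtype.ext huv)
      · intro u v huv
        have hne := col.valid huv
        split_ifs with h1 h2 h2
        · exact absurd (h1.trans h2.symm) hne
        · rw [hc.symm, hcol]
        · rw [hcol]
        · omega
    have := card_le_mul_card_image_of_maps_to (s := univ \ A) (t := univ) (f := fun y => c a y)
      (fun _ _ => mem_univ _) h (fun i _ => hfib i)
    simpa [mul_comm] using this
  have := card_sdiff_add_card_eq_card (subset_univ A)
  rw [card_univ, Fintype.card_fin] at this
  omega

variable (H) in
/-- The Gallai-Ramsey number is attained, that is, the infimum is not over the empty set. -/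
lemma gallaiArrows_gallaiRamsey (hk : 1 ≤ k) :
    GallaiArrows k (⊤ : SimpleGraph (Fin (gallaiRamsey k H))) H := by
  refine Nat.sInf_mem (s := {n | GallaiArrows k (⊤ : SimpleGraph (Fin n)) H})
    ⟨(4 ^ Fintype.card V) ^ (k * Fintype.card V) + 1, ?_⟩
  by_contra hnot
  obtain ⟨c, hc, hno⟩ := exists_color_of_not_gallaiArrows hk hnot
  have := hno.card_le_pow hc
  omega

variable (H) in
lemma not_gallaiArrows_pred [Nonempty V] (hk : 1 ≤ k) :
    ¬ GallaiArrows k (⊤ : SimpleGraph (Fin (gallaiRamsey k H - 1))) H := by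
  rcases Nat.eq_zero_or_pos (gallaiRamsey k H) with h0 | hpos
  · have harr := gallaiArrows_gallaiRamsey H hk
    intro _
    rw [h0] at harr
    refine NoMono.not_gallaiArrows (c := fun _ _ => (⟨0, hk⟩ : Fin k)) ?_
      ⟨fun _ _ => rfl, fun _ _ _ => Or.inl rfl⟩ harr
    intro _ f
    exact (f (Classical.arbitrary V)).elim0
  · exact fun h => Nat.notMem_of_lt_sInf (Nat.sub_lt hpos one_pos) h

/-- A good colouring on `m` vertices bounds the Gallai-Ramsey number from below. -/
lemma lt_gallaiRamsey_of_not_gallaiArrows {W : Type*} [Fintype W] (hk : 1 ≤ k)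
    (h : ¬ GallaiArrows k (⊤ : SimpleGraph W) H) : Fintype.card W < gallaiRamsey k H := by
  by_contra! hle
  obtain ⟨f⟩ := Function.Embedding.nonempty_of_card_le (α := Fin (gallaiRamsey k H)) (β := W)
    (by simpa using hle)
  refine h ((gallaiArrows_gallaiRamsey H hk).mono ⟨⟨f, fun {u v} huv => ?_⟩, f.injective⟩)
  exact fun hf => huv (f.injective hf)

lemma card_le_gallaiRamsey [Nonempty V] (hk : 1 ≤ k) : Fintype.card V ≤ gallaiRamsey k H := by
  have := lt_gallaiRamsey_of_not_gallaiArrows (W := Fin (Fintype.card V - 1)) (H := H) hk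
    (NoMono.not_gallaiArrows (c := fun _ _ => (⟨0, hk⟩ : Fin k)) (fun _ f hf _ => by
      have := Fintype.card_le_of_injective f hf
      rw [Fintype.card_fin] at this
      have := Fintype.card_pos (α := V)
      omega) ⟨fun _ _ => rfl, fun _ _ _ => Or.inl rfl⟩)
  rw [Fintype.card_fin] at this
  omega

/-- If `H` has no isolated vertex and is not a star, then colouring `xy` with `min x y` avoids `H`,
because every colour class is a star. -/
lemma lt_gallaiRamsey_of_not_isStar [Nonempty V] (hiso : ∀ v : V, ¬ H.IsIsolated v)
    (hH : ¬ IsStar H) (hk : 1 ≤ k) : k < gallaiRamsey k H := by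
  have := lt_gallaiRamsey_of_not_gallaiArrows (W := Fin k) (H := H) hk
    (NoMono.not_gallaiArrows (c := fun x y => min x y) ?_
      ⟨fun x y => min_comm x y, fun x y z => by grind⟩)
  · simpa using this
  intro i f hf hall
  have hcenter : ∀ u v, H.Adj u v → f u = i ∨ f v = i := fun u v huv => by
    have := hall u v huv
    rcases min_choice (f u) (f v) with h | h
    · exact Or.inl (h.symm.trans this)
    · exact Or.inr (h.symm.trans this)
  obtain ⟨r, hr⟩ : ∃ r, f r = i := by
    obtain ⟨v⟩ := ‹Nonempty V›
    have := hiso v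
    simp only [SimpleGraph.IsIsolated, not_forall, not_not] at this
    obtain ⟨w, hw⟩ := this
    exact (hcenter v w hw).elim (fun h => ⟨v, h⟩) (fun h => ⟨w, h⟩)
  have heq : ∀ u, f u = i → u = r := fun u hu => hf (hu.trans hr.symm)
  refine hH ⟨r, ?_⟩
  ext u v
  rw [starGraph_adj]
  constructor
  · exact fun huv => ⟨huv.ne, (hcenter u v huv).imp (heq u) (heq v)⟩
  · have key : ∀ v, r ≠ v → H.Adj r v := by
      intro v hv
      have := hiso v
      simp only [SimpleGraph.IsIsolated, not_forall, not_not] at this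
      obtain ⟨w, hw⟩ := this
      rcases hcenter v w hw with h | h
      · exact absurd (heq v h).symm hv
      · rw [← heq w h]
        exact hw.symm
    rintro ⟨hne, rfl | rfl⟩
    · exact key v hne
    · exact (key u hne.symm).symm

/-- Colouring pairs of `0`-`1` sequences by the first position where they differ avoids every
non-bipartite graph, because every colour class is bipartite. -/
lemma two_pow_lt_gallaiRamsey (hH : ¬ H.IsBipartite) (hk : 1 ≤ k) :
    2 ^ k < gallaiRamsey k H := by
  classical
  -- `d x y` is the first position where `x` and `y` differ, with an irrelevant value for `x = y`
  have hex : ∀ x y : Fin k → Bool, ∃ i : Fin k, (∀ j < i, x j = y j) ∧ (x ≠ y → x i ≠ y i) := by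
    intro x y
    by_cases hxy : x = y
    · exact ⟨⟨0, hk⟩, fun j _ => by rw [hxy], fun h => absurd hxy h⟩
    · obtain ⟨i, hi⟩ := Function.ne_iff.1 hxy
      obtain ⟨m, hm, hmin⟩ := exists_min_image (univ.filter (fun j => x j ≠ y j)) id ⟨i, by simpa⟩
      refine ⟨m, fun j hj => ?_, fun _ => (mem_filter.1 hm).2⟩
      by_contra hne
      exact absurd (hmin j (by simpa using hne)) (not_le.2 hj)
  choose e heq hne using hex
  have huniq : ∀ x y i, (∀ j < i, x j = y j) → x i ≠ y i → e x y = i := by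
    intro x y i h1 h2
    have hxy : x ≠ y := fun h => h2 (by rw [h])
    rcases lt_trichotomy (e x y) i with h | h | h
    · exact absurd (h1 _ h) (hne x y hxy)
    · exact h
    · exact absurd (heq x y i h) h2
  have hsymm : ∀ x y, x ≠ y → e x y = e y x := fun x y hxy =>
    huniq x y _ (fun j hj => (heq y x j hj).symm) (hne y x hxy.symm).symm
  have hsymm' : ∀ x y, e x y = e y x := fun x y => by
    by_cases hxy : x = y
    · rw [hxy]
    · exact hsymm x y hxy
  have htri : ∀ x y z, e x y = e x z ∨ e x y = e y z ∨ e x z = e y z := by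
    intro x y z
    by_cases hxy : x = y
    · subst hxy; exact Or.inr (Or.inr rfl)
    by_cases hyz : y = z
    · subst hyz; exact Or.inl rfl
    by_cases hxz : x = z
    · subst hxz; exact Or.inr (Or.inl (hsymm' _ _))
    rcases lt_trichotomy (e x y) (e x z) with h | h | h
    · refine Or.inr (Or.inl (huniq y z _ (fun j hj => ?_) ?_).symm)
      · rw [← heq x y j hj, heq x z j (hj.trans h)]
      · rw [← heq x z _ h]
        exact (hne x y hxy).symm
    · exact Or.inl h
    · refine Or.inr (Or.inr (huniq y z _ (fun j hj => ?_) ?_).symm)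
      · rw [← heq x y j (hj.trans h), heq x z j hj]
      · rw [← heq x y _ h]
        exact hne x z hxz
  have := lt_gallaiRamsey_of_not_gallaiArrows (W := Fin k → Bool) (H := H) hk
    (NoMono.not_gallaiArrows (c := e) ?_ ⟨hsymm', htri⟩)
  · simpa using this
  intro i f hf hall
  refine hH (Coloring.mk (fun v => f v i) ?_ : H.Coloring Bool).colorable
  intro u v huv h
  have hne' := hne (f u) (f v) (fun h => huv.ne (hf h))
  rw [hall u v huv] at hne'
  exact hne' h

/-! ### The star-critical Gallai-Ramsey number -/

/-- The star-critical number is attained: `K_{n-1} ⊔ K_{1,n-1}` is the complete graph on `n`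
vertices, so that `s = n - 1` is admissible. -/
lemma starCriticalGallaiRamsey_mem [Nonempty V] (hk : 1 ≤ k) :
    starCriticalGallaiRamsey k H ≤ gallaiRamsey k H - 1 ∧
      GallaiArrows k (completeWithStar (gallaiRamsey k H - 1) (starCriticalGallaiRamsey k H)) H := by
  refine Nat.sInf_mem (s := {s : ℕ | s ≤ gallaiRamsey k H - 1 ∧
    GallaiArrows k (completeWithStar (gallaiRamsey k H - 1) s) H})
    ⟨gallaiRamsey k H - 1, le_rfl, ?_⟩
  have hpos : 0 < gallaiRamsey k H := Fintype.card_pos.trans_le (card_le_gallaiRamsey hk)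
  obtain ⟨f⟩ := Function.Embedding.nonempty_of_card_le (α := Fin (gallaiRamsey k H))
    (β := Option (Fin (gallaiRamsey k H - 1))) (by simp; omega)
  refine (gallaiArrows_gallaiRamsey H hk).mono ⟨⟨f, fun {u v} huv => ?_⟩, f.injective⟩
  have hne : f u ≠ f v := fun h => huv (f.injective h)
  rcases hu : f u with _ | i <;> rcases hv : f v with _ | j
  · exact absurd (hu.trans hv.symm) hne
  · exact j.2
  · exact i.2
  · rintro rfl
    exact hne (hu.trans hv.symm)

/-- Let `A` be a module with at least `|H| - 1` vertices of a good colouring of the complete graph.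
A new vertex may be joined to all vertices outside `A`, in the colours in which they are joined to
`A`: in a monochromatic copy of `H` that uses it, some vertex of `A` could take its place. -/
lemma IsModule.not_gallaiArrows_completeWithStar {N s : ℕ} {c : Fin N → Fin N → Fin k}
    {A : Finset (Fin N)} (hA : IsModule c univ A) (hc : IsGallai c) (hno : NoMono c H)
    (hiso : ∀ v : V, ¬ H.IsIsolated v) (hne : A.Nonempty) (hcard : Fintype.card V ≤ #A + 1)
    (hs : s + #A ≤ N) : ¬ GallaiArrows k (completeWithStar N s) H := by
  classical
  obtain ⟨a, ha⟩ := hne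
  -- relabel the vertices so that the neighbours of the new vertex lie outside `A`
  obtain ⟨σ, hσ⟩ : ∃ σ : Fin N → Fin N, Function.Injective σ ∧
      ∀ j : Fin N, (j : ℕ) < s → σ j ∉ A := by
    have hcompl := card_compl A
    rw [Fintype.card_fin] at hcompl
    obtain ⟨g⟩ := Function.Embedding.nonempty_of_card_le
      (α := {j : Fin N // (j : ℕ) < s}) (β := (Aᶜ : Finset (Fin N))) (by
        rw [Fintype.card_coe, hcompl, Fintype.card_subtype]
        refine le_trans (card_le_card_of_injOn (t := range s) (fun j => (j : ℕ)) ?_ ?_) ?_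
        · intro j hj
          simpa using hj
        · exact fun _ _ _ _ h => Fin.ext h
        · rw [card_range]
          omega)
    let f : Fin N → Fin N := fun j => if h : (j : ℕ) < s then g ⟨j, h⟩ else j
    have hf : ∀ (j : Fin N) (h : (j : ℕ) < s), f j = g ⟨j, h⟩ := fun j h => dif_pos h
    obtain ⟨σ, hσ⟩ := exists_equiv_extend_of_card_eq (α := Fin N) (β := Fin N) (t := univ)
      (by simp) (s := univ.filter (fun j => (j : ℕ) < s)) (f := f) (subset_univ _) (by
        intro x hx y hy hxy
        have hx' : (x : ℕ) < s := by simpa using hx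
        have hy' : (y : ℕ) < s := by simpa using hy
        rw [hf x hx', hf y hy'] at hxy
        exact congrArg Subtype.val (g.injective (Subtype.ext hxy)))
    refine ⟨fun j => σ j, Subtype.val_injective.comp σ.injective, fun j hj => ?_⟩
    dsimp only
    rw [hσ j (by simpa using hj), hf j hj]
    exact mem_compl.1 (g _).2
  let φ : Option (Fin N) → Fin N := fun x => x.elim a σ
  refine not_gallaiArrows_of_color _ (hc.comp φ) ?_
  intro i f hf hall
  have hφ : ∀ x y, x ≠ none → y ≠ none → φ x = φ y → x = y := by
    rintro (_ | x) (_ | y) hx hy hxy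
    · rfl
    · exact absurd rfl hx
    · exact absurd rfl hy
    · exact congrArg some (hσ.1 hxy)
  by_cases hnone : ∃ v₀, f v₀ = none
  · obtain ⟨v₀, hv₀⟩ := hnone
    have hnb : ∀ u, H.Adj v₀ u → φ (f u) ∉ A := by
      intro u hu
      have := (hall v₀ u hu).1
      rw [hv₀] at this
      rcases hfu : f u with _ | j
      · rw [hfu] at this
        exact this.elim
      · rw [hfu] at this
        exact hσ.2 j this
    obtain ⟨u₀, hu₀⟩ : ∃ u, H.Adj v₀ u := by
      simpa [SimpleGraph.IsIsolated] using hiso v₀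
    -- a vertex of `A` outside the copy; at most `|H| - 2` vertices of the copy lie in `A`,
    -- since neither the new vertex nor its neighbour `u₀` does
    obtain ⟨a', ha', hout⟩ : ∃ a' ∈ A, a' ∉ ((univ.erase v₀).erase u₀).image (fun v => φ (f v)) := by
      refine exists_mem_notMem_of_card_lt_card (card_image_le.trans_lt ?_)
      have h1 := card_erase_of_mem (s := univ.erase v₀) (a := u₀) (by simp [hu₀.ne'])
      have h2 := card_erase_of_mem (mem_univ v₀)
      have h3 := card_pos.2 ⟨a, ha⟩
      rw [card_univ] at h2
      omega
    have hout' : ∀ v, v ≠ v₀ → φ (f v) ≠ a' := by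
      intro v hv hva
      by_cases hvu : v = u₀
      · subst hvu
        exact hnb v hu₀ (hva ▸ ha')
      · exact hout (mem_image.2 ⟨v, by simp [hv, hvu], hva⟩)
    have hsome : ∀ v, v ≠ v₀ → f v ≠ none := fun v hv h => hv (hf (h.trans hv₀.symm))
    have hedge : ∀ u, H.Adj v₀ u → c a' (φ (f u)) = i := by
      intro u hu
      rw [hA.2 a' ha' a ha _ (mem_univ _) (hnb u hu)]
      have := (hall v₀ u hu).2
      rwa [hv₀] at this
    refine hno i (fun v => if v = v₀ then a' else φ (f v)) ?_ ?_
    · intro u v huv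
      dsimp only at huv
      split_ifs at huv with h1 h2 h2
      · rw [h1, h2]
      · exact absurd huv.symm (hout' v h2)
      · exact absurd huv (hout' u h1)
      · exact hf (hφ _ _ (hsome u h1) (hsome v h2) huv)
    · intro u v huv
      split_ifs with h1 h2 h2
      · exact absurd (h1.trans h2.symm) huv.ne
      · exact hedge v (h1 ▸ huv)
      · rw [hc.symm]
        exact hedge u (h2 ▸ huv.symm)
      · exact (hall u v huv).2
  · push Not at hnone
    exact hno i (fun v => φ (f v)) (fun u v huv => hf (hφ _ _ (hnone u) (hnone v) huv))
      fun u v huv => (hall u v huv).2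

/-- The star-critical number differs from the Gallai-Ramsey number by at most a constant. -/
lemma gallaiRamsey_le_starCritical_add [Nonempty V] (hiso : ∀ v : V, ¬ H.IsIsolated v)
    (hk : 1 ≤ k) :
    1 ≤ starCriticalGallaiRamsey k H ∧
      gallaiRamsey k H ≤
        starCriticalGallaiRamsey k H + 4 ^ Fintype.card V * (Fintype.card V + 1) := by
  obtain ⟨hle, harr⟩ := starCriticalGallaiRamsey_mem (H := H) hk
  obtain ⟨c, hc, hno⟩ := exists_color_of_not_gallaiArrows hk (not_gallaiArrows_pred H hk)
  have hV : 2 ≤ Fintype.card V := by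
    obtain ⟨v⟩ := ‹Nonempty V›
    obtain ⟨u, hu⟩ : ∃ u, H.Adj v u := by
      simpa [SimpleGraph.IsIsolated] using hiso v
    exact Fintype.one_lt_card_iff.2 ⟨v, u, hu.ne⟩
  have hn := card_le_gallaiRamsey (H := H) hk
  have hmod : ∀ A, IsModule c univ A → Fintype.card V ≤ #A + 1 →
      gallaiRamsey k H - 1 < starCriticalGallaiRamsey k H + #A := by
    intro A hA hcard
    by_contra! hs
    exact hA.not_gallaiArrows_completeWithStar hc hno hiso (card_pos.1 (by omega)) hcard hs harr
  constructor
  · have := hmod univ ⟨Subset.rfl, fun _ _ _ _ y hy hy' => absurd hy hy'⟩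
      (by rw [card_univ, Fintype.card_fin]; omega)
    rw [card_univ, Fintype.card_fin] at this
    omega
  · obtain ⟨A, hA, h1, h2⟩ := exists_module_of_size (S := univ) hc (Fintype.card V - 1)
      (by rw [card_univ, Fintype.card_fin]; omega) (fun T _ i hT => hno.card_clique_lt T i hT)
    have h3 := hmod A hA (by omega)
    have h4 : 4 ^ Fintype.card V * (Fintype.card V - 1 + 1) ≤
        4 ^ Fintype.card V * (Fintype.card V + 1) := Nat.mul_le_mul_left _ (by omega)
    omega

/-- The multiplicative form of `gallaiRamsey_le_starCritical_add`, valid for all `k ≥ 1` because the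
star-critical number is positive. -/
lemma gallaiRamsey_le_mul_starCritical [Nonempty V] (hiso : ∀ v : V, ¬ H.IsIsolated v) (hk : 1 ≤ k) :
    gallaiRamsey k H ≤
      (4 ^ Fintype.card V * (Fintype.card V + 1) + 1) * starCriticalGallaiRamsey k H := by
  obtain ⟨h1, h2⟩ := gallaiRamsey_le_starCritical_add hiso hk
  nlinarith [Nat.zero_le (4 ^ Fintype.card V * (Fintype.card V + 1))]

end Bounds

end GallaiRamsey

theorem theorem5p1 {V : Type*} [Fintype V] [Nonempty V] (H : SimpleGraph V)
    (hiso : ∀ v : V, ¬ H.IsIsolated v) :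
    (H.IsBipartite → ¬ GallaiRamsey.IsStar H →
      ∃ a b : ℝ, 0 < a ∧ 0 < b ∧ ∀ k : ℕ, 1 ≤ k →
        a * (k : ℝ) ≤ (GallaiRamsey.starCriticalGallaiRamsey k H : ℝ) ∧
        (GallaiRamsey.starCriticalGallaiRamsey k H : ℝ) ≤ b * (k : ℝ)) ∧
    (¬ H.IsBipartite →
      ∃ a b p q : ℝ, 0 < a ∧ 0 < b ∧ 1 < p ∧ 1 < q ∧ ∀ k : ℕ, 1 ≤ k →
        a * p ^ k ≤ (GallaiRamsey.starCriticalGallaiRamsey k H : ℝ) ∧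
        (GallaiRamsey.starCriticalGallaiRamsey k H : ℝ) ≤ b * q ^ k) := by
  have hV : 0 < Fintype.card V := Fintype.card_pos
  set h := Fintype.card V with hh
  set D := 4 ^ h * (h + 1) with hD
  have hDpos : (0 : ℝ) < (D + 1 : ℕ) := by positivity
  have hlower : ∀ k m : ℕ, 1 ≤ k → m < GallaiRamsey.gallaiRamsey k H →
      ((D + 1 : ℕ) : ℝ)⁻¹ * m ≤ (GallaiRamsey.starCriticalGallaiRamsey k H : ℝ) := by
    intro k m hk hm
    rw [inv_mul_le_iff₀ hDpos]
    exact_mod_cast hm.le.trans (GallaiRamsey.gallaiRamsey_le_mul_starCritical hiso hk)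
  refine ⟨fun hbip hstar => ⟨((D + 1 : ℕ) : ℝ)⁻¹, ((D + h : ℕ) : ℝ), by positivity, by positivity,
    fun k hk => ⟨hlower k k hk (GallaiRamsey.lt_gallaiRamsey_of_not_isStar hiso hstar hk), ?_⟩⟩,
    fun hbip => ⟨((D + 1 : ℕ) : ℝ)⁻¹, 1, 2, ((4 ^ h) ^ h : ℕ), by positivity, one_pos, one_lt_two,
      ?_, fun k hk => ⟨?_, ?_⟩⟩⟩
  · obtain ⟨c, hc, hno⟩ := GallaiRamsey.exists_color_of_not_gallaiArrows hk
      (GallaiRamsey.not_gallaiArrows_pred H hk)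
    have h1 := (GallaiRamsey.starCriticalGallaiRamsey_mem (H := H) hk).1
    have h2 := hno.card_le_of_isBipartite hc hbip
    rw [← hh, ← hD] at h2
    have h3 : D * 1 ≤ D * k := Nat.mul_le_mul_left _ hk
    have : GallaiRamsey.starCriticalGallaiRamsey k H ≤ (D + h) * k := by
      rw [add_mul, mul_comm h]
      omega
    exact_mod_cast this
  · exact_mod_cast Nat.one_lt_pow hV.ne' (Nat.one_lt_pow hV.ne' (by norm_num))
  · have := hlower k (2 ^ k) hk (GallaiRamsey.two_pow_lt_gallaiRamsey hbip hk)
    push_cast at this ⊢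
    exact this
  · obtain ⟨c, hc, hno⟩ := GallaiRamsey.exists_color_of_not_gallaiArrows hk
      (GallaiRamsey.not_gallaiArrows_pred H hk)
    have h1 := (GallaiRamsey.starCriticalGallaiRamsey_mem (H := H) hk).1
    have h2 := hno.card_le_pow hc
    have : GallaiRamsey.starCriticalGallaiRamsey k H ≤ ((4 ^ h) ^ h) ^ k := by
      rw [← pow_mul _ h, mul_comm h k]
      exact h1.trans h2
    rw [one_mul]
    exact_mod_cast this
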